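/- Let $G$ be a (non-empty) finite simple graph with minimum degree at least $2$. Assume that for every vertex $v$ of $G$ of degree $2$ there is a vertex $a$ of $G$ whose distance from $v$ in $G$ (the length of a shortest path between $v$ and $a$, taken to be $\infty$ if there is no such path) is at least $3$. Then the dominance complex $\mathrm{Dom}(G)$ is $1$-connected. Here $\mathrm{Dom}(G)$ is the simplicial complex whose simplices are the subsets $\sigma \subseteq V(G)$ such that $V(G) \setminus \sigma$ is dominating in $G$, i.e. every vertex of $G$ belongs to $V(G) \setminus \sigma$ or is adjacent to an element of $V(G) \setminus \sigma$. A simplicial complex is called $1$-connected if its geometric realization $X$ is non-empty and, for every base point $x \in X$, both $\pi_0(X,x)$ and $\pi_1(X,x)$ are trivial. -/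

import Mathlib

open scoped Topology

/-- A set `σ` of vertices is dominating in `G` if every vertex of `G` lies in `σ` or is adjacent
to an element of `σ`. -/
def SimpleGraph.IsDominatingSet {V : Type*} (G : SimpleGraph V) (σ : Set V) : Prop :=
  ∀ v : V, v ∈ σ ∨ ∃ u ∈ σ, G.Adj v u

theorem SimpleGraph.IsDominatingSet.mono {V : Type*} {G : SimpleGraph V} {σ τ : Set V}
    (h : G.IsDominatingSet σ) (hστ : σ ⊆ τ) : G.IsDominatingSet τ := fun v =>
  (h v).imp (fun hv => hστ hv) (fun ⟨u, hu, huv⟩ => ⟨u, hστ hu, huv⟩)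

/-- The dominance complex of `G`: its simplices are the sets of vertices whose complement is
dominating in `G`. Following the convention of Mathlib, only the nonempty simplices are listed;
elements of `V` that are not vertices of the complex (ghost vertices) are allowed. -/
def SimpleGraph.dominanceComplex {V : Type*} (G : SimpleGraph V) :
    PreAbstractSimplicialComplex V where
  faces := {σ | σ.Nonempty ∧ G.IsDominatingSet (σ : Set V)ᶜ}
  isRelLowerSet_faces := fun _ hσ => ⟨hσ.1, fun _ hτσ hτ =>
    ⟨hτ, hσ.2.mono (Set.compl_subset_compl.2 (Finset.coe_subset.2 hτσ))⟩⟩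

/-- The geometric realization of a simplicial complex with finite underlying set `V`, in
barycentric coordinates: the points of the standard simplex on `V` supported on a simplex of `K`.
It carries the topology induced from `V → ℝ`. -/
def PreAbstractSimplicialComplex.realization {V : Type*} [Fintype V]
    (K : PreAbstractSimplicialComplex V) : Set (V → ℝ) :=
  {x | x ∈ stdSimplex ℝ V ∧ ∃ σ ∈ K, ∀ v, v ∉ σ → x v = 0}

/-- A topological space `X` is `k`-connected if it is nonempty and `π_i(X, x)` is trivial for all
`i ≤ k` and all base points `x` (for `i = 0` this is the set of path components). -/
def IsKConnected (k : ℕ) (X : Type*) [TopologicalSpace X] : Prop :=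
  Nonempty X ∧ ∀ i ≤ k, ∀ x : X, Subsingleton (π_ i X x)

/-! Since all degrees are at least 2, closed neighborhoods have at least three vertices, so every
set of at most two vertices is a face and a missing triple is the closed neighborhood of a vertex
`v` of degree 2. If `a` is at distance at least 3 from `v`, the cone from `a` over the boundary of
that triple lies in the complex (`exists_cone_mem_dominanceComplex`). So the 1-skeleton is complete
and every triangle boundary is null-homotopic, whence edge classes compose transitively. This kills
the fundamental group without simplicial approximation: the edge classes extend to a transitive
choice of path class between any two points, which agrees with all small paths and hence, by
connectedness of the interval, with all paths. -/

open Set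

/-! ### Path classes: from local to global -/

section PathClasses

variable {X : Type*} [TopologicalSpace X]

/-- If a transitive family of homotopy classes of paths contains every sufficiently small path,
then it contains every path. -/
theorem Path.Homotopic.Quotient.mk_eq_of_locally
    (F : ∀ x y : X, Path.Homotopic.Quotient x y)
    (hF : ∀ x y z, (F x y).trans (F y z) = F x z)
    (hloc : ∀ x, ∃ U ∈ 𝓝 x, ∀ (y z : X) (γ : Path y z), range γ ⊆ U → mk γ = F y z)
    {x y : X} (γ : Path x y) : mk γ = F x y := by
  have hrefl : ∀ x, F x x = refl x := fun x => by
    obtain ⟨U, hU, h⟩ := hloc x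
    refine (h x x (Path.refl x) ?_).symm
    rintro _ ⟨t, rfl⟩
    exact mem_of_mem_nhds hU
  have hinv : ∀ x y, (F x y).trans (F y x) = refl x := fun x y => by rw [hF, hrefl]
  have hnear : ∀ t₀ : unitInterval, ∀ᶠ t in 𝓝 t₀, mk (γ.subpath t₀ t) = F (γ t₀) (γ t) := by
    intro t₀
    obtain ⟨U, hU, h⟩ := hloc (γ t₀)
    have hmem : γ ⁻¹' U ∈ 𝓝 t₀ := γ.continuous.continuousAt hU
    have hlim : Filter.Tendsto (fun t => uIcc t₀ t) (𝓝 t₀) (𝓝 t₀).smallSets :=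
      tendsto_const_nhds.uIcc Filter.tendsto_id
    filter_upwards [hlim.eventually (Filter.eventually_smallSets_subset.2 hmem)] with t ht
    exact h _ _ _ (by rw [Path.range_subpath]; exact image_subset_iff.2 ht)
  have hsub : ∀ s t u : unitInterval, (mk (γ.subpath s t)).trans (mk (γ.subpath t u)) =
      mk (γ.subpath s u) := fun s t u =>
    Quotient.sound ⟨Path.Homotopy.subpathTransSubpath γ s t u⟩
  -- Membership in `S` is locally constant, so `S` is clopen; it contains 0.
  let S : Set unitInterval := {t | mk (γ.subpath 0 t) = F (γ 0) (γ t)}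
  have hS : ∀ t₀ : unitInterval, ∀ᶠ t in 𝓝 t₀, (t ∈ S ↔ t₀ ∈ S) := by
    intro t₀
    filter_upwards [hnear t₀] with t ht
    change mk _ = _ ↔ mk _ = _
    rw [← hsub 0 t₀ t, ht]
    constructor
    · intro h
      have := congrArg (fun c => c.trans (F (γ t) (γ t₀))) h
      simpa only [Path.Homotopic.Quotient.trans_assoc, hinv, hF, hrefl,
        Path.Homotopic.Quotient.trans_refl] using this
    · intro h
      rw [h, hF]
  have hclopen : IsClopen S := by
    refine ⟨⟨isOpen_iff_mem_nhds.2 fun t₀ ht₀ => ?_⟩, isOpen_iff_mem_nhds.2 fun t₀ ht₀ => ?_⟩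
    · filter_upwards [hS t₀] with t ht using fun h => ht₀ (ht.1 h)
    · filter_upwards [hS t₀] with t ht using ht.2 ht₀
  have huniv : S = univ := hclopen.eq_univ ⟨0, by
    change mk _ = _
    rw [Path.subpath_self, hrefl]; rfl⟩
  have h1 : mk (γ.subpath 0 1) = F (γ 0) (γ 1) := by
    have : (1 : unitInterval) ∈ S := huniv ▸ mem_univ _
    exact this
  rw [Path.subpath_zero_one] at h1
  -- `γ 0` and `x` are only propositionally equal, so the endpoints are generalized before
  -- substitution.
  have key : ∀ (a b : X) (ha : a = x) (hb : b = y), mk (γ.cast ha hb) = F a b →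
      mk γ = F x y := by
    rintro a b rfl rfl h
    exact h
  exact key _ _ _ _ h1

/-- A space is simply connected if it carries a transitive family of homotopy classes of paths
that contains every sufficiently small path. -/
theorem SimplyConnectedSpace.of_locally [Nonempty X]
    (F : ∀ x y : X, Path.Homotopic.Quotient x y)
    (hF : ∀ x y z, (F x y).trans (F y z) = F x z)
    (hloc : ∀ x, ∃ U ∈ 𝓝 x, ∀ (y z : X) (γ : Path y z), range γ ⊆ U →
      Path.Homotopic.Quotient.mk γ = F y z) : SimplyConnectedSpace X := by
  refine simply_connected_iff_paths_homotopic.2 ⟨⟨inferInstance, fun x y => ?_⟩, fun x y => ⟨?_⟩⟩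
  · exact ⟨(F x y).out⟩
  · intro p q
    induction p using Path.Homotopic.Quotient.ind with | mk p =>
    induction q using Path.Homotopic.Quotient.ind with | mk q =>
    rw [Path.Homotopic.Quotient.mk_eq_of_locally F hF hloc p,
      Path.Homotopic.Quotient.mk_eq_of_locally F hF hloc q]

theorem SimplyConnectedSpace.isKConnected_one [SimplyConnectedSpace X] : IsKConnected 1 X := by
  refine ⟨inferInstance, fun i hi x => ?_⟩
  interval_cases i
  · have : Subsingleton (ZerothHomotopy X) := inferInstance
    exact (HomotopyGroup.pi0EquivZerothHomotopy (x := x)).subsingleton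
  · have : Subsingleton (FundamentalGroup X x) := inferInstance
    exact (HomotopyGroup.pi1EquivFundamentalGroup (x := x)).subsingleton

end PathClasses

/-! ### Straight paths and star-shaped sets -/

section Segments

variable {E : Type*} [AddCommGroup E] [Module ℝ E] [TopologicalSpace E] [ContinuousAdd E]
  [ContinuousSMul ℝ E] {R S : Set E}

/-- A nonempty star-shaped set is contractible, so the homotopy exists in `S` and is pushed into
`R`. -/
theorem Path.homotopic_of_mem_starConvex {c : E} (hS : StarConvex ℝ c S) (hSR : S ⊆ R)
    {x y : R} (p q : Path x y) (hp : ∀ t, (p t : E) ∈ S) (hq : ∀ t, (q t : E) ∈ S) :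
    p.Homotopic q := by
  have hx : (x : E) ∈ S := by simpa using hp 0
  have hy : (y : E) ∈ S := by simpa using hp 1
  have : ContractibleSpace S := hS.contractibleSpace ⟨_, hx⟩
  let lift (r : Path x y) (hr : ∀ t, (r t : E) ∈ S) : Path (⟨x, hx⟩ : S) ⟨y, hy⟩ :=
    { toFun := fun t => ⟨r t, hr t⟩
      continuous_toFun := by fun_prop
      source' := by simp
      target' := by simp }
  exact (SimplyConnectedSpace.paths_homotopic (lift p hp) (lift q hq)).map
    ⟨Set.inclusion hSR, continuous_inclusion hSR⟩

/-- The straight path between two points of a set that contains the segment between them. -/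
def Path.ofSegment (x y : R) (h : segment ℝ (x : E) y ⊆ R) : Path x y where
  toFun t := ⟨(1 - (t : ℝ)) • (x : E) + (t : ℝ) • (y : E),
    h ⟨1 - t, t, sub_nonneg.2 t.2.2, t.2.1, sub_add_cancel _ _, rfl⟩⟩
  continuous_toFun := by fun_prop
  source' := by simp
  target' := by simp

theorem Path.ofSegment_mem_segment (x y : R) (h : segment ℝ (x : E) y ⊆ R) (t : unitInterval) :
    (Path.ofSegment x y h t : E) ∈ segment ℝ (x : E) y :=
  ⟨1 - t, t, sub_nonneg.2 t.2.2, t.2.1, sub_add_cancel _ _, rfl⟩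

theorem Path.trans_mem {X : Type*} [TopologicalSpace X] {T : Set X} {x y z : X} {p : Path x y}
    {q : Path y z} (hp : ∀ t, p t ∈ T) (hq : ∀ t, q t ∈ T) (t : unitInterval) : p.trans q t ∈ T := by
  have : p.trans q t ∈ range p ∪ range q := Path.trans_range p q ▸ mem_range_self t
  rcases this with ⟨s, hs⟩ | ⟨s, hs⟩
  · exact hs ▸ hp s
  · exact hs ▸ hq s

/-- The homotopy class of the straight path. -/
def segmentClass (x y : R) (h : segment ℝ (x : E) y ⊆ R) : Path.Homotopic.Quotient x y :=
  .mk (Path.ofSegment x y h)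

theorem segmentClass_trans {C : Set E} (hC : Convex ℝ C) (hCR : C ⊆ R) {x y z : R}
    (hx : (x : E) ∈ C) (hy : (y : E) ∈ C) (hz : (z : E) ∈ C)
    (hxy : segment ℝ (x : E) y ⊆ R) (hyz : segment ℝ (y : E) z ⊆ R)
    (hxz : segment ℝ (x : E) z ⊆ R) :
    (segmentClass x y hxy).trans (segmentClass y z hyz) = segmentClass x z hxz :=
  Quotient.sound <| Path.homotopic_of_mem_starConvex (hC.starConvex hx) hCR _ _
    (Path.trans_mem (T := {w : R | (w : E) ∈ C})
      (fun _ => hC.segment_subset hx hy (Path.ofSegment_mem_segment ..))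
      (fun _ => hC.segment_subset hy hz (Path.ofSegment_mem_segment ..)))
    (fun _ => hC.segment_subset hx hz (Path.ofSegment_mem_segment ..))

theorem mk_eq_segmentClass_trans {c : R} (hS : StarConvex ℝ (c : E) S) (hSR : S ⊆ R)
    {x y : R} (γ : Path x y) (hγ : ∀ t, (γ t : E) ∈ S)
    (hxc : segment ℝ (x : E) c ⊆ R) (hcy : segment ℝ (c : E) y ⊆ R) :
    Path.Homotopic.Quotient.mk γ = (segmentClass x c hxc).trans (segmentClass c y hcy) := by
  have hx : (x : E) ∈ S := by simpa using hγ 0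
  have hy : (y : E) ∈ S := by simpa using hγ 1
  refine Quotient.sound <| Path.homotopic_of_mem_starConvex hS hSR _ _ hγ
    (Path.trans_mem (T := {w : R | (w : E) ∈ S}) (fun t => ?_) (fun t => ?_))
  · have := Path.ofSegment_mem_segment x c hxc t
    rw [segment_symm] at this
    exact hS.segment_subset hx this
  · exact hS.segment_subset hy (Path.ofSegment_mem_segment c y hcy t)

end Segments

/-! ### Simple connectivity of realizations -/

namespace PreAbstractSimplicialComplex

variable {V : Type*} [Fintype V]

/-- The geometric simplex spanned by a set of vertices. -/
def geometricSimplex (σ : Finset V) : Set (V → ℝ) :=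
  {x | x ∈ stdSimplex ℝ V ∧ ∀ v, v ∉ σ → x v = 0}

theorem convex_geometricSimplex (σ : Finset V) : Convex ℝ (geometricSimplex σ) := by
  intro x hx y hy a b ha hb hab
  refine ⟨convex_stdSimplex ℝ V hx.1 hy.1 ha hb hab, fun v hv => ?_⟩
  simp [hx.2 v hv, hy.2 v hv]

theorem single_mem_geometricSimplex [DecidableEq V] {σ : Finset V} {v : V} (hv : v ∈ σ) :
    Pi.single v 1 ∈ geometricSimplex σ :=
  ⟨single_mem_stdSimplex ℝ v, fun u hu =>
    Pi.single_eq_of_ne (by rintro rfl; exact hu hv) _⟩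

variable {K : PreAbstractSimplicialComplex V}

theorem geometricSimplex_subset_realization {σ : Finset V} (hσ : σ ∈ K) :
    geometricSimplex σ ⊆ K.realization :=
  fun _ hx => ⟨hx.1, σ, hσ, hx.2⟩

theorem segment_subset_realization {σ : Finset V} (hσ : σ ∈ K) {x y : V → ℝ}
    (hx : x ∈ geometricSimplex σ) (hy : y ∈ geometricSimplex σ) :
    segment ℝ x y ⊆ K.realization :=
  ((convex_geometricSimplex σ).segment_subset hx hy).trans (geometricSimplex_subset_realization hσ)

variable (K) in
/-- The union of the geometric simplices of `K` that contain the vertex `v`. -/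
def closedStar (v : V) : Set (V → ℝ) :=
  {x | ∃ σ ∈ K, v ∈ σ ∧ x ∈ geometricSimplex σ}

theorem closedStar_subset_realization (v : V) : K.closedStar v ⊆ K.realization :=
  fun _ ⟨_, hσ, _, hx⟩ => geometricSimplex_subset_realization hσ hx

theorem starConvex_closedStar [DecidableEq V] (v : V) :
    StarConvex ℝ (Pi.single v 1) (K.closedStar v) := by
  rintro x ⟨σ, hσ, hv, hx⟩ a b ha hb hab
  exact ⟨σ, hσ, hv, convex_geometricSimplex σ (single_mem_geometricSimplex hv) hx ha hb hab⟩

theorem exists_face_of_ne_zero {x : V → ℝ} (hx : x ∈ K.realization) {v : V} (hv : x v ≠ 0) :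
    ∃ σ ∈ K, v ∈ σ ∧ x ∈ geometricSimplex σ := by
  obtain ⟨hx, σ, hσ, h⟩ := hx
  exact ⟨σ, hσ, by_contra fun hvσ => hv (h v hvσ), hx, h⟩

theorem exists_ne_zero_of_mem_stdSimplex {x : V → ℝ} (hx : x ∈ stdSimplex ℝ V) :
    ∃ v, x v ≠ 0 := by
  by_contra! h
  simpa [h] using hx.2

/-- The realization of a complex is simply connected if any three vertices `u`, `v`, `w` admit a
vertex `a` such that the cone with apex `a` over the boundary of the triangle `u v w` is contained
in the complex. -/
theorem simplyConnectedSpace_realization [Nonempty V] [DecidableEq V]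
    (h : ∀ u v w : V, ∃ a, ({a, u, v} : Finset V) ∈ K ∧ {a, v, w} ∈ K ∧ {a, u, w} ∈ K) :
    SimplyConnectedSpace K.realization := by
  have hedge : ∀ u v : V, ∃ σ ∈ K, u ∈ σ ∧ v ∈ σ := fun u v => by
    obtain ⟨a, ha, -⟩ := h u v v
    exact ⟨_, ha, by simp, by simp⟩
  let c (v : V) : K.realization := ⟨Pi.single v 1, by
    obtain ⟨σ, hσ, hv, -⟩ := hedge v v
    exact geometricSimplex_subset_realization hσ (single_mem_geometricSimplex hv)⟩
  have : Nonempty K.realization := ⟨c (Classical.arbitrary V)⟩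
  have hcc (u v : V) : segment ℝ (c u : V → ℝ) (c v) ⊆ K.realization := by
    obtain ⟨σ, hσ, hu, hv⟩ := hedge u v
    exact segment_subset_realization hσ (single_mem_geometricSimplex hu)
      (single_mem_geometricSimplex hv)
  have hxc (x : K.realization) (v : V) (hv : x.1 v ≠ 0) :
      segment ℝ (x : V → ℝ) (c v) ⊆ K.realization := by
    obtain ⟨σ, hσ, hvσ, hx⟩ := exists_face_of_ne_zero x.2 hv
    exact segment_subset_realization hσ hx (single_mem_geometricSimplex hvσ)
  have hcx (x : K.realization) (v : V) (hv : x.1 v ≠ 0) :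
      segment ℝ (c v : V → ℝ) x ⊆ K.realization := by
    rw [segment_symm]
    exact hxc x v hv
  let e (u v : V) := segmentClass (c u) (c v) (hcc u v)
  have he_face {σ : Finset V} (hσ : σ ∈ K) {u v w : V} (hu : u ∈ σ) (hv : v ∈ σ) (hw : w ∈ σ) :
      (e u v).trans (e v w) = e u w :=
    segmentClass_trans (convex_geometricSimplex σ) (geometricSimplex_subset_realization hσ)
      (single_mem_geometricSimplex hu) (single_mem_geometricSimplex hv)
      (single_mem_geometricSimplex hw) _ _ _
  -- The triple `u v w` need not be a face: `e u v` is detoured through the apex `a`, and the three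
  -- faces of the cone do the rest.
  have he (u v w : V) : (e u v).trans (e v w) = e u w := by
    obtain ⟨a, ha₁, ha₂, ha₃⟩ := h u v w
    rw [← he_face ha₁ (u := u) (v := a) (w := v) (by simp) (by simp) (by simp),
      Path.Homotopic.Quotient.trans_assoc,
      he_face ha₂ (u := a) (v := v) (w := w) (by simp) (by simp) (by simp),
      he_face ha₃ (u := u) (v := a) (w := w) (by simp) (by simp) (by simp)]
  choose φ hφ using fun x : K.realization => exists_ne_zero_of_mem_stdSimplex x.2.1
  have hto (x : K.realization) (v w : V) (hv : x.1 v ≠ 0) (hw : x.1 w ≠ 0) :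
      (segmentClass x (c v) (hxc x v hv)).trans (e v w) = segmentClass x (c w) (hxc x w hw) := by
    obtain ⟨hx, σ, hσ, hxσ⟩ := x.2
    exact segmentClass_trans (convex_geometricSimplex σ) (geometricSimplex_subset_realization hσ)
      ⟨hx, hxσ⟩ (single_mem_geometricSimplex (by_contra fun h => hv (hxσ v h)))
      (single_mem_geometricSimplex (by_contra fun h => hw (hxσ w h))) _ _ _
  have hfrom (x : K.realization) (v w : V) (hv : x.1 v ≠ 0) (hw : x.1 w ≠ 0) :
      (e v w).trans (segmentClass (c w) x (hcx x w hw)) = segmentClass (c v) x (hcx x v hv) := by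
    obtain ⟨hx, σ, hσ, hxσ⟩ := x.2
    exact segmentClass_trans (convex_geometricSimplex σ) (geometricSimplex_subset_realization hσ)
      (single_mem_geometricSimplex (by_contra fun h => hv (hxσ v h)))
      (single_mem_geometricSimplex (by_contra fun h => hw (hxσ w h))) ⟨hx, hxσ⟩ _ _ _
  have hback (x : K.realization) (v : V) (hv : x.1 v ≠ 0) :
      (segmentClass (c v) x (hcx x v hv)).trans (segmentClass x (c v) (hxc x v hv)) = e v v := by
    obtain ⟨σ, hσ, hvσ, hx⟩ := exists_face_of_ne_zero x.2 hv
    exact segmentClass_trans (convex_geometricSimplex σ) (geometricSimplex_subset_realization hσ)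
      (single_mem_geometricSimplex hvσ) hx (single_mem_geometricSimplex hvσ) _ _ _
  -- The chosen class goes straight to a vertex `φ x` of the support of `x`, along an edge to `φ y`,
  -- then straight to `y`.
  refine SimplyConnectedSpace.of_locally
    (fun x y => (segmentClass x (c (φ x)) (hxc x _ (hφ x))).trans
      ((e (φ x) (φ y)).trans (segmentClass (c (φ y)) y (hcx y _ (hφ y))))) ?_ ?_
  · intro x y z
    simp only [Path.Homotopic.Quotient.trans_assoc]
    congr 1
    rw [← Path.Homotopic.Quotient.trans_assoc (segmentClass _ y _), hback y _ (hφ y),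
      ← Path.Homotopic.Quotient.trans_assoc (e (φ y) (φ y)), he,
      ← Path.Homotopic.Quotient.trans_assoc, he]
  · intro x
    -- The open star of `φ x`: paths in it stay in the closed star, which is star-shaped about that
    -- vertex.
    refine ⟨{y | y.1 (φ x) ≠ 0}, ?_, fun y z γ hγ => ?_⟩
    · refine (isOpen_ne_fun ?_ continuous_const).mem_nhds (hφ x)
      exact (continuous_apply (φ x)).comp continuous_subtype_val
    · have hγ' (t : unitInterval) : (γ t).1 (φ x) ≠ 0 := hγ (mem_range_self t)
      have hy : y.1 (φ x) ≠ 0 := by simpa using hγ' 0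
      have hz : z.1 (φ x) ≠ 0 := by simpa using hγ' 1
      rw [mk_eq_segmentClass_trans (c := c (φ x)) (starConvex_closedStar (φ x))
        (closedStar_subset_realization _) γ
        (fun t => exists_face_of_ne_zero (γ t).2 (hγ' t)) (hxc y _ hy) (hcx z _ hz),
        ← hto y (φ y) (φ x) (hφ y) hy, ← hfrom z (φ x) (φ z) hz (hφ z),
        Path.Homotopic.Quotient.trans_assoc, ← Path.Homotopic.Quotient.trans_assoc (e _ _), he]

end PreAbstractSimplicialComplex

/-! ### Small faces of the dominance complex -/

namespace SimpleGraph

variable {V : Type*} {G : SimpleGraph V}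

theorem mem_dominanceComplex_iff {σ : Finset V} :
    σ ∈ G.dominanceComplex ↔
      σ.Nonempty ∧ ∀ v, ¬ (v ∈ σ ∧ ∀ u, G.Adj v u → u ∈ σ) := by
  change σ.Nonempty ∧ (∀ v, _) ↔ _
  refine and_congr_right fun _ => forall_congr' fun v => ?_
  simp only [mem_compl_iff, Finset.mem_coe]
  grind

theorem edist_lt_three_of_adj {u v : V} (h : G.Adj u v) : G.edist u v < 3 := by
  rw [edist_eq_one_iff_adj.2 h]
  norm_num

theorem edist_lt_three_of_adj_adj {u v w : V} (huv : G.Adj u v) (hvw : G.Adj v w) :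
    G.edist u w < 3 := by
  refine (G.edist_triangle (v := v)).trans_lt ?_
  rw [edist_eq_one_iff_adj.2 huv, edist_eq_one_iff_adj.2 hvw]
  norm_num

variable [Fintype V] [DecidableEq V] [DecidableRel G.Adj]

/-- In a graph of minimum degree at least `2`, the only triples that are not simplices of the
dominance complex are the closed neighborhoods of vertices of degree `2`. -/
theorem eq_insert_neighborFinset_of_notMem_dominanceComplex (hmin : 2 ≤ G.minDegree)
    {σ : Finset V} (hne : σ.Nonempty) (hcard : σ.card ≤ 3) (hσ : σ ∉ G.dominanceComplex) :
    ∃ v, G.degree v = 2 ∧ insert v (G.neighborFinset v) = σ := by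
  rw [mem_dominanceComplex_iff] at hσ
  push Not at hσ
  obtain ⟨v, hv, hadj⟩ := hσ hne
  have hsub : insert v (G.neighborFinset v) ⊆ σ := by
    intro u hu
    rcases Finset.mem_insert.1 hu with rfl | hu
    · exact hv
    · exact hadj u ((G.mem_neighborFinset v u).1 hu)
  have hc : (insert v (G.neighborFinset v)).card = G.degree v + 1 := by
    rw [Finset.card_insert_of_notMem (by simp), card_neighborFinset_eq_degree]
  have hd := G.minDegree_le_degree v
  have hle := Finset.card_le_card hsub
  exact ⟨v, by omega, Finset.eq_of_subset_of_card_le hsub (by omega)⟩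

/-- A triple containing a vertex `a` at distance at least `3` from a vertex `v` and otherwise
contained in the closed neighborhood of `v` is a simplex of the dominance complex. -/
theorem triple_mem_dominanceComplex (hmin : 2 ≤ G.minDegree) {v a x y : V}
    (ha : 3 ≤ G.edist v a) (hx : x = v ∨ G.Adj v x) (hy : y = v ∨ G.Adj v y) :
    {a, x, y} ∈ G.dominanceComplex := by
  by_contra hn
  obtain ⟨w, hw, hs⟩ := eq_insert_neighborFinset_of_notMem_dominanceComplex hmin
    (by simp) Finset.card_le_three hn
  -- No vertex of the closed neighborhood of `v` equals or neighbors `a`. A missing triple would be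
  -- the closed neighborhood of one of its members `w`, forcing such a vertex.
  have hnv : ∀ z, z = v ∨ G.Adj v z → ¬ (z = a ∨ G.Adj z a) := by
    rintro z (rfl | hz) (rfl | hza)
    · simp at ha
    · exact ha.not_gt (edist_lt_three_of_adj hza)
    · exact ha.not_gt (edist_lt_three_of_adj hz)
    · exact ha.not_gt (edist_lt_three_of_adj_adj hz hza)
  have hwmem : w ∈ ({a, x, y} : Finset V) := hs ▸ Finset.mem_insert_self _ _
  have hmem : ∀ z ∈ ({a, x, y} : Finset V), z = w ∨ G.Adj w z := fun z hz => by
    rw [← hs] at hz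
    simpa using hz
  have haw := hmem a (by simp)
  have hxw := hmem x (by simp)
  simp only [Finset.mem_insert, Finset.mem_singleton] at hwmem
  rcases hwmem with rfl | rfl | rfl
  · exact hnv x hx (hxw.imp id fun h => h.symm)
  · exact hnv w hx (haw.imp Eq.symm id)
  · exact hnv w hy (haw.imp Eq.symm id)

theorem exists_cone_mem_dominanceComplex (hmin : 2 ≤ G.minDegree)
    (hdist : ∀ v : V, G.degree v = 2 → ∃ a : V, 3 ≤ G.edist v a) (x y z : V) :
    ∃ a, ({a, x, y} : Finset V) ∈ G.dominanceComplex ∧ {a, y, z} ∈ G.dominanceComplex ∧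
      {a, x, z} ∈ G.dominanceComplex := by
  by_cases h : ({x, y, z} : Finset V) ∈ G.dominanceComplex
  · have hsub : ∀ σ : Finset V, σ ⊆ {x, y, z} → σ.Nonempty → σ ∈ G.dominanceComplex :=
      fun σ hσ hne => (G.dominanceComplex.isRelLowerSet_faces h).2 hσ hne
    -- With apex `x`, two of the triples degenerate to edges of the face `{x, y, z}`.
    exact ⟨x, hsub _ (by grind) (by simp), h, hsub _ (by grind) (by simp)⟩
  · obtain ⟨v, hv, hs⟩ := eq_insert_neighborFinset_of_notMem_dominanceComplex hmin
      (by simp) Finset.card_le_three h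
    obtain ⟨a, ha⟩ := hdist v hv
    have hmem : ∀ u ∈ ({x, y, z} : Finset V), u = v ∨ G.Adj v u := fun u hu => by
      rw [← hs] at hu
      simpa using hu
    have hx := hmem x (by simp)
    have hy := hmem y (by simp)
    have hz := hmem z (by simp)
    exact ⟨a, triple_mem_dominanceComplex hmin ha hx hy, triple_mem_dominanceComplex hmin ha hy hz,
      triple_mem_dominanceComplex hmin ha hx hz⟩

end SimpleGraph

theorem mainTheorem7 {V : Type*} [Fintype V] [Nonempty V]
    (G : SimpleGraph V) [DecidableRel G.Adj]
    (hmin : 2 ≤ G.minDegree)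
    (hdist : ∀ v : V, G.degree v = 2 → ∃ a : V, 3 ≤ G.edist v a) :
    IsKConnected 1 G.dominanceComplex.realization := by
  classical
  have := PreAbstractSimplicialComplex.simplyConnectedSpace_realization
    (SimpleGraph.exists_cone_mem_dominanceComplex hmin hdist)
  exact SimplyConnectedSpace.isKConnected_one
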